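/- Let $F$ be the distribution function of a probability law on $\mathbb R^d$ supported on $[0,\infty)^d$, and let $\boldsymbol X_1,\boldsymbol X_2,\dots$ be i.i.d. random vectors with distribution function $F$. For $n\ge 1$ let $F_n(\boldsymbol y)=\frac1n\sum_{i=1}^n \mathbb I\{\boldsymbol X_i\le \boldsymbol y\}$ (coordinatewise inequality) be the empirical distribution function and, for $\boldsymbol m=(m_1,\dots,m_d)$ with positive integer entries and $\boldsymbol x\in[0,\infty)^d$, define the Szász–Mirakyan estimator $$F_{\boldsymbol m,n}(\boldsymbol x)=\sum_{\boldsymbol k\in\mathbb N_0^d}F_n\Big(\frac{k_1}{m_1},\dots,\frac{k_d}{m_d}\Big)\prod_{j=1}^d e^{-m_jx_j}\frac{(m_jx_j)^{k_j}}{k_j!}.$$ Write $m_{\min}=\min_{1\le j\le d}m_j$. Assume that $F$ is twice continuously differentiable on $(0,\infty)^d$ and that for every compact $S\subset(0,\infty)^d$ there are $\delta_S>0$ and $M_S<\infty$ such that $|\partial_{x_i}F(\boldsymbol y)|\le M_S$ and $|\partial^2_{x_ix_j}F(\boldsymbol y)|\le M_S$ for all $1\le i,j\le d$ and all $\boldsymbol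 y\in(0,\infty)^d$ with $\|\boldsymbol y-\boldsymbol z\|_1\le\delta_S$ for some $\boldsymbol z\in S$. Fix $\boldsymbol x\in(0,\infty)^d$ with $0<F(\boldsymbol x)<1$, and let $\boldsymbol m=\boldsymbol m(n)$ be a sequence of smoothing vectors with $m_{\min}\to\infty$ as $n\to\infty$. Then $F_{\boldsymbol m,n}(\boldsymbol x)$ is integrable for every $n$, and the following hold as $n\to\infty$. (a) $\sqrt n\,\{F_{\boldsymbol m,n}(\boldsymbol x)-\mathbb E[F_{\boldsymbol m,n}(\boldsymbol x)]\}\xrightarrow{d}\mathcal N\big(0,\,F(\boldsymbol x)\{1-F(\boldsymbol x)\}\big)$. (b) If, in addition, $\sqrt n\,m_{\min}^{-1}\to0$, then $\sqrt n\,\{F_{\boldsymbol m,n}(\boldsymbol x)-F(\boldsymbol x)\}\xrightarrow{d}\mathcal N\big(0,\,F(\boldsymbol x)\{1-F(\boldsymbol x)\}\big)$. -/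

import Mathlib

open MeasureTheory ProbabilityTheory Filter
open scoped Topology

noncomputable section

namespace SzaszMirakyan

/-- The distribution function `F(x) = μ {y | y ≤ x}` (coordinatewise order) of a law `μ` on `ℝᵈ`. -/
def distFun {d : ℕ} (μ : Measure (Fin d → ℝ)) (x : Fin d → ℝ) : ℝ :=
  μ.real (Set.Iic x)

/-- The product-Poisson weights
`P_{k,m}(x) = ∏ⱼ exp(-mⱼ xⱼ) (mⱼ xⱼ)^{kⱼ} / kⱼ!`. -/
def poissonWeight {d : ℕ} (k m : Fin d → ℕ) (x : Fin d → ℝ) : ℝ :=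
  ∏ j, Real.exp (-(m j * x j)) * (m j * x j) ^ k j / (Nat.factorial (k j) : ℝ)

/-- The empirical distribution function `Fₙ(x) = n⁻¹ ∑ᵢ 1{Xᵢ ≤ x}` of the sample points
`X 0, …, X (n - 1)`. -/
def empiricalCDF {d : ℕ} (n : ℕ) (X : ℕ → Fin d → ℝ) (x : Fin d → ℝ) : ℝ :=
  (1 / (n : ℝ)) * ∑ i ∈ Finset.range n, (Set.Iic x).indicator (fun _ => (1 : ℝ)) (X i)

/-- The Szász–Mirakyan distribution estimator
`F_{m,n}(x) = ∑_{k ∈ ℕ₀ᵈ} Fₙ(k₁/m₁, …, k_d/m_d) P_{k,m}(x)` built on the sample points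
`X 0, …, X (n - 1)`. -/
def estimator {d : ℕ} (m : Fin d → ℕ) (n : ℕ) (X : ℕ → Fin d → ℝ) (x : Fin d → ℝ) : ℝ :=
  ∑' k : Fin d → ℕ, empiricalCDF n X (fun j => (k j : ℝ) / (m j : ℝ)) * poissonWeight k m x

/-- `m_min = minⱼ mⱼ`. -/
def mMin {d : ℕ} (m : Fin d → ℕ) : ℕ := ⨅ j, m j

/-- The open orthant `(0,∞)ᵈ`. -/
def openOrthant (d : ℕ) : Set (Fin d → ℝ) := {y | ∀ j, 0 < y j}

/-- The partial derivative `∂ᵢ f (y)`. -/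
def partialDeriv {d : ℕ} (i : Fin d) (f : (Fin d → ℝ) → ℝ) (y : Fin d → ℝ) : ℝ :=
  lineDeriv ℝ f y (Pi.single i 1)

/-- The set of points of `(0,∞)ᵈ` within `ℓ¹`-distance `δ` of a point of `S`. -/
def l1Neighborhood {d : ℕ} (δ : ℝ) (S : Set (Fin d → ℝ)) : Set (Fin d → ℝ) :=
  {y | y ∈ openOrthant d ∧ ∃ z ∈ S, ∑ j, |y j - z j| ≤ δ}

/-- Interior regularity: `F` is twice continuously differentiable on `(0,∞)ᵈ`, and its first and
second partial derivatives are bounded in a neighbourhood of each compact `S ⊆ (0,∞)ᵈ`. -/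
structure InteriorC2 {d : ℕ} (F : (Fin d → ℝ) → ℝ) : Prop where
  contDiffOn : ContDiffOn ℝ 2 F (openOrthant d)
  bounds : ∀ S : Set (Fin d → ℝ), IsCompact S → S ⊆ openOrthant d →
    ∃ δ > (0 : ℝ), ∃ M : ℝ, ∀ y ∈ l1Neighborhood δ S,
      (∀ i, |partialDeriv i F y| ≤ M) ∧
      (∀ i j, |partialDeriv i (partialDeriv j F) y| ≤ M)

/-- The Poisson weights, being those of a product of Poisson laws, are summable. -/
theorem summable_poissonWeight {d : ℕ} (m : Fin d → ℕ) (x : Fin d → ℝ) (hx : ∀ j, 0 ≤ x j) :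
    Summable fun k : Fin d → ℕ => poissonWeight k m x := by
  obtain ⟨r, hr⟩ : ∃ r : Fin d → NNReal, ∀ j, (r j : ℝ) = m j * x j :=
    ⟨fun j => (m j * x j).toNNReal, fun j =>
      Real.coe_toNNReal _ (mul_nonneg (Nat.cast_nonneg _) (hx j))⟩
  have h : ∀ k : Fin d → ℕ, poissonWeight k m x =
      (Measure.pi (fun j => poissonMeasure (r j)) {k}).toReal := by
    intro k
    rw [Measure.pi_singleton, ENNReal.toReal_prod]
    refine Finset.prod_congr rfl fun j _ => ?_
    have := poissonMeasure_real_singleton (r j) (k j)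
    rw [Measure.real] at this
    rw [this, hr]
  simp_rw [h]
  refine ENNReal.summable_toReal ?_
  have h2 := Measure.tsum_indicator_apply_singleton
    (Measure.pi (fun j => poissonMeasure (r j))) Set.univ MeasurableSet.univ
  simp only [Set.indicator_univ] at h2
  rw [h2]
  exact measure_ne_top _ _

/-- The series defining the estimator converges absolutely. -/
theorem summable_estimator {d : ℕ} (m : Fin d → ℕ) (n : ℕ) (X : ℕ → Fin d → ℝ)
    (x : Fin d → ℝ) (hx : ∀ j, 0 ≤ x j) :
    Summable fun k : Fin d → ℕ =>
      empiricalCDF n X (fun j => (k j : ℝ) / (m j : ℝ)) * poissonWeight k m x := by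
  refine Summable.of_norm_bounded
    (g := fun k => ((1 / (n : ℝ)) * n) * poissonWeight k m x)
    ((summable_poissonWeight m x hx).mul_left _) fun k => ?_
  have hw : 0 ≤ poissonWeight k m x := Finset.prod_nonneg fun j _ => by
    have := hx j
    positivity
  have h0 : ∀ i, 0 ≤ (Set.Iic fun j => (k j : ℝ) / (m j : ℝ)).indicator
      (fun _ => (1 : ℝ)) (X i) := fun i => Set.indicator_nonneg (fun _ _ => zero_le_one) _
  have hs : ∑ i ∈ Finset.range n, (Set.Iic fun j => (k j : ℝ) / (m j : ℝ)).indicator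
      (fun _ => (1 : ℝ)) (X i) ≤ n := by
    refine (Finset.sum_le_card_nsmul _ _ 1 fun i _ => ?_).trans (by simp)
    exact Set.indicator_le_self' (fun _ _ => zero_le_one) _
  rw [norm_mul, Real.norm_of_nonneg hw, empiricalCDF, Real.norm_of_nonneg
    (mul_nonneg (by positivity) (Finset.sum_nonneg fun i _ => h0 i))]
  gcongr

end SzaszMirakyan

end

open scoped NNReal

namespace SzaszMirakyan

/-! The estimator is linear in the empirical distribution function, so it is the sample mean of
`smoothedIndicator m x (X i)`, where the smoothed indicator at `y` is the probability that `y ≤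
K/m`, with independent Poisson coordinates `K j` of mean `m j * x j`. The vector `K/m` has mean `x`
and coordinate variances `x j / m j`, hence concentrates at `x` as `mMin m → ∞`.

For (a), the smoothed indicator of `y` tends to `1{y ≤ x}` unless `y` lies on the boundary of the
orthant below `x` (`tendsto_smoothedIndicator`), a null set because `F` is continuous at `x`
(`ae_le_imp_lt`). The differences `D n` therefore vanish in `L²(μ)`, and Chebyshev makes their
normalised centred sums negligible (`tendstoInMeasure_normalized_sum`). The classical central limit
theorem for `1{X i ≤ x}` and Slutsky's lemma conclude; no triangular-array theorem is needed.

For (b), Fubini identifies the mean of the estimator with `szaszOperator m x F`. In a first-order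
Taylor expansion of `F` at `x` the linear term averages to zero and the quadratic remainder costs
`O(1 / mMin m)` (`abs_szaszOperator_sub_le`), so `√n` times the bias vanishes. -/

/-! ### Moments of the Poisson law -/

theorem hasSum_poisson_descFactorial (r : ℝ≥0) (p : ℕ) :
    HasSum (fun n : ℕ => (Real.exp (-r) * r ^ n / n.factorial) * (n.descFactorial p : ℝ))
      ((r : ℝ) ^ p) := by
  -- The first `p` terms vanish; after the shift, the falling factorial cancels against the
  -- factorial and leaves `r ^ p` times the Poisson weights.
  rw [← hasSum_nat_add_iff' p]
  have h0 : ∑ i ∈ Finset.range p,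
      (Real.exp (-r) * r ^ i / i.factorial) * (i.descFactorial p : ℝ) = 0 :=
    Finset.sum_eq_zero fun i hi => by
      rw [Nat.descFactorial_of_lt (Finset.mem_range.1 hi)]; simp
  rw [h0, sub_zero]
  have h := (hasSum_one_poissonMeasure r).mul_left ((r : ℝ) ^ p)
  rw [mul_one] at h
  refine h.congr_fun fun n => ?_
  have h1 : ((n.factorial * (n + p).descFactorial p : ℕ) : ℝ) = (n + p).factorial := by
    rw [← Nat.factorial_mul_descFactorial (Nat.le_add_left p n), Nat.add_sub_cancel]
  have h2 : (n.factorial : ℝ) ≠ 0 := by positivity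
  have h3 : ((n + p).factorial : ℝ) ≠ 0 := by positivity
  push_cast at h1
  field_simp
  rw [← h1]
  ring

theorem integrable_poisson_descFactorial (r : ℝ≥0) (p : ℕ) :
    Integrable (fun n : ℕ => (n.descFactorial p : ℝ)) (poissonMeasure r) := by
  rw [integrable_poissonMeasure_iff]
  simpa using (hasSum_poisson_descFactorial r p).summable

theorem integral_poisson_descFactorial (r : ℝ≥0) (p : ℕ) :
    ∫ n : ℕ, (n.descFactorial p : ℝ) ∂(poissonMeasure r) = (r : ℝ) ^ p := by
  rw [integral_poissonMeasure]
  exact (hasSum_poisson_descFactorial r p).tsum_eq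

/-- Falling factorials have Poisson means `r ^ p`, so this expansion gives the variance as `r² + (1
- 2r) r + r² = r`. -/
theorem sub_sq_eq_descFactorial (r : ℝ) (n : ℕ) :
    ((n : ℝ) - r) ^ 2 =
      n.descFactorial 2 + (1 - 2 * r) * n.descFactorial 1 + r ^ 2 * n.descFactorial 0 := by
  cases n with
  | zero => simp
  | succ n => simp [Nat.descFactorial]; ring

theorem integrable_poisson_sub (r : ℝ≥0) :
    Integrable (fun n : ℕ => (n : ℝ) - r) (poissonMeasure r) := by
  have := integrable_poisson_descFactorial r 1
  simp only [Nat.descFactorial_one] at this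
  exact this.sub (integrable_const _)

theorem integral_poisson_sub (r : ℝ≥0) :
    ∫ n : ℕ, ((n : ℝ) - r) ∂(poissonMeasure r) = 0 := by
  have h1 := integrable_poisson_descFactorial r 1
  have h2 := integral_poisson_descFactorial r 1
  simp only [Nat.descFactorial_one] at h1 h2
  rw [integral_sub h1 (integrable_const _), h2]
  simp

theorem integrable_poisson_sub_sq (r : ℝ≥0) :
    Integrable (fun n : ℕ => ((n : ℝ) - r) ^ 2) (poissonMeasure r) := by
  simp_rw [sub_sq_eq_descFactorial]
  exact ((integrable_poisson_descFactorial r 2).add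
    ((integrable_poisson_descFactorial r 1).const_mul _)).add
    ((integrable_poisson_descFactorial r 0).const_mul _)

/-- The variance of the Poisson law. -/
theorem integral_poisson_sub_sq (r : ℝ≥0) :
    ∫ n : ℕ, ((n : ℝ) - r) ^ 2 ∂(poissonMeasure r) = r := by
  simp_rw [sub_sq_eq_descFactorial]
  rw [integral_add, integral_add, integral_const_mul, integral_const_mul,
    integral_poisson_descFactorial, integral_poisson_descFactorial,
    integral_poisson_descFactorial]
  · ring
  · exact integrable_poisson_descFactorial r 2
  · exact (integrable_poisson_descFactorial r 1).const_mul _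
  · exact (integrable_poisson_descFactorial r 2).add
      ((integrable_poisson_descFactorial r 1).const_mul _)
  · exact (integrable_poisson_descFactorial r 0).const_mul _

/-! ### The Szász–Mirakyan operator and its approximation error -/

/-- The product of the Poisson laws with rates `mⱼ xⱼ`. -/
noncomputable def poissonPi {d : ℕ} (m : Fin d → ℕ) (x : Fin d → ℝ) : Measure (Fin d → ℕ) :=
  Measure.pi fun j => poissonMeasure (m j * x j).toNNReal

instance {d : ℕ} (m : Fin d → ℕ) (x : Fin d → ℝ) : IsProbabilityMeasure (poissonPi m x) := by
  unfold poissonPi; infer_instance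

/-- The Szász–Mirakyan operator `φ ↦ 𝔼 φ(K₁/m₁, …, K_d/m_d)`, the `Kⱼ` being independent Poisson
variables with means `mⱼ xⱼ`. -/
noncomputable def szaszOperator {d : ℕ} (m : Fin d → ℕ) (x : Fin d → ℝ)
    (φ : (Fin d → ℝ) → ℝ) : ℝ :=
  ∫ k, φ (fun j => (k j : ℝ) / (m j : ℝ)) ∂(poissonPi m x)

variable {d : ℕ} {m : Fin d → ℕ} {x : Fin d → ℝ}

theorem poissonPi_real_singleton (hx : ∀ j, 0 ≤ x j) (k : Fin d → ℕ) :
    (poissonPi m x).real {k} = poissonWeight k m x := by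
  rw [poissonPi, Measure.real, Measure.pi_singleton, ENNReal.toReal_prod, poissonWeight]
  refine Finset.prod_congr rfl fun j _ => ?_
  have := poissonMeasure_real_singleton (m j * x j).toNNReal (k j)
  rw [Measure.real] at this
  rw [this, Real.coe_toNNReal _ (mul_nonneg (Nat.cast_nonneg _) (hx j))]

theorem integrable_poissonPi_of_bound {φ : (Fin d → ℝ) → ℝ} (hφ : ∀ y, |φ y| ≤ 1) :
    Integrable (fun k : Fin d → ℕ => φ (fun j => (k j : ℝ) / (m j : ℝ))) (poissonPi m x) :=
  Integrable.of_bound (Measurable.of_discrete.aestronglyMeasurable) 1 (ae_of_all _ fun _ => hφ _)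

theorem szaszOperator_eq_tsum (hx : ∀ j, 0 ≤ x j) {φ : (Fin d → ℝ) → ℝ} (hφ : ∀ y, |φ y| ≤ 1) :
    szaszOperator m x φ =
      ∑' k : Fin d → ℕ, φ (fun j => (k j : ℝ) / (m j : ℝ)) * poissonWeight k m x := by
  rw [szaszOperator, integral_countable (integrable_poissonPi_of_bound hφ)]
  simp_rw [poissonPi_real_singleton hx, smul_eq_mul, mul_comm]

theorem abs_szaszOperator_le {φ : (Fin d → ℝ) → ℝ} (hφ : ∀ y, |φ y| ≤ 1) :
    |szaszOperator m x φ| ≤ 1 := by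
  have := norm_integral_le_of_norm_le_const (μ := poissonPi m x) (C := 1)
    (f := fun k => φ (fun j => (k j : ℝ) / (m j : ℝ))) (ae_of_all _ fun _ => hφ _)
  simpa [szaszOperator] using this

section moments

variable (hm : ∀ j, 1 ≤ m j) (hx : ∀ j, 0 ≤ x j)
include hm hx

theorem ratio_sub_eq (k : ℕ) (j : Fin d) :
    (k : ℝ) / m j - x j = (m j : ℝ)⁻¹ * (k - ((m j * x j).toNNReal : ℝ)) := by
  have : (m j : ℝ) ≠ 0 := by have := hm j; positivity
  rw [Real.coe_toNNReal _ (mul_nonneg (Nat.cast_nonneg _) (hx j))]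
  field_simp

theorem integrable_ratio_sub (j : Fin d) :
    Integrable (fun k : Fin d → ℕ => (k j : ℝ) / m j - x j) (poissonPi m x) := by
  simp_rw [ratio_sub_eq hm hx]
  exact ((measurePreserving_eval (fun j => poissonMeasure (m j * x j).toNNReal)
    j).integrable_comp_of_integrable (integrable_poisson_sub _)).const_mul _

theorem integral_ratio_sub (j : Fin d) :
    ∫ k : Fin d → ℕ, ((k j : ℝ) / m j - x j) ∂(poissonPi m x) = 0 := by
  simp_rw [ratio_sub_eq hm hx]
  rw [integral_const_mul, poissonPi,
    integral_comp_eval (μ := fun j => poissonMeasure (m j * x j).toNNReal) (i := j)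
      (f := fun n : ℕ => (n : ℝ) - ((m j * x j).toNNReal : ℝ))
      Measurable.of_discrete.aestronglyMeasurable, integral_poisson_sub, mul_zero]

theorem integrable_ratio_sub_sq (j : Fin d) :
    Integrable (fun k : Fin d → ℕ => ((k j : ℝ) / m j - x j) ^ 2) (poissonPi m x) := by
  simp_rw [ratio_sub_eq hm hx, mul_pow]
  exact ((measurePreserving_eval (fun j => poissonMeasure (m j * x j).toNNReal)
    j).integrable_comp_of_integrable (integrable_poisson_sub_sq _)).const_mul _

theorem integral_ratio_sub_sq (j : Fin d) :
    ∫ k : Fin d → ℕ, ((k j : ℝ) / m j - x j) ^ 2 ∂(poissonPi m x) = x j / m j := by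
  have : (m j : ℝ) ≠ 0 := by have := hm j; positivity
  simp_rw [ratio_sub_eq hm hx, mul_pow]
  rw [integral_const_mul, poissonPi,
    integral_comp_eval (μ := fun j => poissonMeasure (m j * x j).toNNReal) (i := j)
      (f := fun n : ℕ => ((n : ℝ) - ((m j * x j).toNNReal : ℝ)) ^ 2)
      Measurable.of_discrete.aestronglyMeasurable, integral_poisson_sub_sq,
    Real.coe_toNNReal _ (mul_nonneg (Nat.cast_nonneg _) (hx j))]
  field_simp

theorem sum_div_le_div_mMin : ∑ j, x j / m j ≤ (∑ j, x j) / mMin m := by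
  rw [Finset.sum_div]
  refine Finset.sum_le_sum fun j _ => ?_
  -- An infimum over an empty index set would be `0` in `ℕ`; the index `j` excludes this case.
  have : Nonempty (Fin d) := ⟨j⟩
  have h1 : 1 ≤ mMin m := le_ciInf hm
  have h2 : mMin m ≤ m j := ciInf_le (OrderBot.bddBelow _) j
  have := hx j
  gcongr

/-- The Szász–Mirakyan operator has error `O(1 / m_min)` at a point where the function has a
quadratic first-order Taylor remainder. -/
theorem abs_szaszOperator_sub_le {φ : (Fin d → ℝ) → ℝ} (hφ : ∀ y, |φ y| ≤ 1)
    (L : (Fin d → ℝ) →L[ℝ] ℝ) {C : ℝ} (hC0 : 0 ≤ C)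
    (hC : ∀ y, |φ y - φ x - L (y - x)| ≤ C * ‖y - x‖ ^ 2) :
    |szaszOperator m x φ - φ x| ≤ C * (∑ j, x j) / mMin m := by
  set ξ : (Fin d → ℕ) → Fin d → ℝ := fun k j => (k j : ℝ) / m j with hξ
  have hLeq : ∀ k, L (ξ k - x) = ∑ j, (ξ k j - x j) * L (Pi.single j 1) := fun k => by
    conv_lhs => rw [pi_eq_sum_univ' (ξ k - x), map_sum]
    refine Finset.sum_congr rfl fun j _ => ?_
    rw [map_smul, smul_eq_mul, Pi.sub_apply]
  -- The linear term drops out because each `k j / m j` has mean `x j`.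
  have hL : ∫ k, L (ξ k - x) ∂(poissonPi m x) = 0 := by
    simp_rw [hLeq]
    rw [integral_finsetSum _ fun j _ => (integrable_ratio_sub hm hx j).mul_const _]
    exact Finset.sum_eq_zero fun j _ => by
      rw [integral_mul_const, integral_ratio_sub hm hx, zero_mul]
  have hLi : Integrable (fun k => L (ξ k - x)) (poissonPi m x) := by
    simp_rw [hLeq]
    exact integrable_finsetSum _ fun j _ => (integrable_ratio_sub hm hx j).mul_const _
  have hφi : Integrable (fun k => φ (ξ k)) (poissonPi m x) := integrable_poissonPi_of_bound hφ
  have hsi : Integrable (fun k => C * ∑ j, (ξ k j - x j) ^ 2) (poissonPi m x) :=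
    (integrable_finsetSum _ fun j _ => integrable_ratio_sub_sq hm hx j).const_mul _
  have hnorm : ∀ k, ‖ξ k - x‖ ^ 2 ≤ ∑ j, (ξ k j - x j) ^ 2 := fun k => by
    have h0 : 0 ≤ ∑ j, (ξ k j - x j) ^ 2 := Finset.sum_nonneg fun _ _ => sq_nonneg _
    rw [← Real.le_sqrt (norm_nonneg _) h0, pi_norm_le_iff_of_nonneg (Real.sqrt_nonneg _)]
    intro j
    rw [Real.norm_eq_abs]
    refine Real.abs_le_sqrt ?_
    exact Finset.single_le_sum (f := fun j => (ξ k j - x j) ^ 2) (fun _ _ => sq_nonneg _)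
      (Finset.mem_univ j)
  have heq : szaszOperator m x φ - φ x =
      ∫ k, (φ (ξ k) - φ x - L (ξ k - x)) ∂(poissonPi m x) := by
    rw [integral_sub (f := fun k => φ (ξ k) - φ x) (hφi.sub (integrable_const _)) hLi, hL,
      integral_sub hφi (integrable_const _)]
    simp [szaszOperator, hξ]
  have hle := norm_integral_le_of_norm_le (μ := poissonPi m x) hsi
    (f := fun k => φ (ξ k) - φ x - L (ξ k - x)) (ae_of_all _ fun k =>
      (hC (ξ k)).trans (mul_le_mul_of_nonneg_left (hnorm k) hC0))
  rw [heq, ← Real.norm_eq_abs]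
  refine hle.trans ?_
  rw [integral_const_mul, integral_finsetSum _ fun j _ => integrable_ratio_sub_sq hm hx j]
  rw [Finset.sum_congr rfl fun j _ => integral_ratio_sub_sq hm hx j, mul_div_assoc]
  exact mul_le_mul_of_nonneg_left (sum_div_le_div_mMin hm hx) hC0

end moments

/-! ### Quadratic Taylor remainders -/

/-- For a bounded function, a local quadratic Taylor remainder bound extends to the whole space. -/
theorem exists_taylor_bound {E : Type*} [NormedAddCommGroup E] [NormedSpace ℝ E] {φ : E → ℝ}
    (hφ : ∀ y, |φ y| ≤ 1) {x : E} (L : E →L[ℝ] ℝ) {K : ℝ}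
    (hK : ∀ᶠ y in 𝓝 x, |φ y - φ x - L (y - x)| ≤ K * ‖y - x‖ ^ 2) :
    ∃ C, 0 ≤ C ∧ ∀ y, |φ y - φ x - L (y - x)| ≤ C * ‖y - x‖ ^ 2 := by
  obtain ⟨δ, hδ, h⟩ := Metric.eventually_nhds_iff.1 hK
  -- Within distance `δ` the term `|K|` suffices. Beyond it, `1 ≤ ‖y - x‖ / δ` turns the crude bound
  -- `2 + ‖L‖ * ‖y - x‖` into a quadratic one.
  refine ⟨|K| + 2 / δ ^ 2 + ‖L‖ / δ, by positivity, fun y => ?_⟩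
  by_cases hy : dist y x < δ
  · refine (h hy).trans ?_
    gcongr
    have h1 : 0 ≤ 2 / δ ^ 2 := by positivity
    have h2 : 0 ≤ ‖L‖ / δ := by positivity
    linarith [le_abs_self K]
  · rw [dist_eq_norm, not_lt] at hy
    have h1 : |φ y - φ x - L (y - x)| ≤ 2 + ‖L‖ * ‖y - x‖ := by
      have a := hφ y
      have b := hφ x
      have c := L.le_opNorm (y - x)
      rw [Real.norm_eq_abs] at c
      rw [abs_le] at *
      constructor <;> linarith
    have h2 : 2 ≤ 2 / δ ^ 2 * ‖y - x‖ ^ 2 := by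
      rw [div_mul_eq_mul_div, le_div_iff₀ (by positivity)]
      gcongr
    have h3 : ‖L‖ * ‖y - x‖ ≤ ‖L‖ / δ * ‖y - x‖ ^ 2 := by
      rw [div_mul_eq_mul_div, le_div_iff₀ hδ, sq, ← mul_assoc]
      gcongr
    have h4 : 0 ≤ |K| * ‖y - x‖ ^ 2 := by positivity
    linarith

/-- A `C²` function has a quadratic first-order Taylor remainder. -/
theorem eventually_taylor_bound {E : Type*} [NormedAddCommGroup E] [NormedSpace ℝ E] {φ : E → ℝ}
    {x : E} (h : ContDiffAt ℝ 2 φ x) :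
    ∃ K : ℝ, ∀ᶠ y in 𝓝 x, |φ y - φ x - fderiv ℝ φ x (y - x)| ≤ K * ‖y - x‖ ^ 2 := by
  have h1 : ContDiffAt ℝ 1 (fderiv ℝ φ) x := h.fderiv_right (by norm_num)
  obtain ⟨K, t, ht, hK⟩ := h1.exists_lipschitzOnWith
  have hd : ∀ᶠ y in 𝓝 x, DifferentiableAt ℝ φ y :=
    (h.eventually (by simp)).mono fun y hy => hy.differentiableAt (by simp)
  obtain ⟨δ, hδ, hball⟩ := Metric.mem_nhds_iff.1 (inter_mem ht hd)
  refine ⟨K, Metric.eventually_nhds_iff.2 ⟨δ, hδ, fun y hy => ?_⟩⟩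
  have hsub : Metric.closedBall x ‖y - x‖ ⊆ Metric.ball x δ :=
    Metric.closedBall_subset_ball (by rwa [← dist_eq_norm])
  have hx0 : x ∈ Metric.closedBall x ‖y - x‖ := Metric.mem_closedBall_self (norm_nonneg _)
  -- Mean value inequality on the ball of radius `‖y - x‖`, where the Lipschitz derivative differs
  -- from its value at `x` by at most `K * ‖y - x‖`.
  have := (convex_closedBall x ‖y - x‖).norm_image_sub_le_of_norm_hasFDerivWithin_le'
    (f := φ) (f' := fderiv ℝ φ) (φ := fderiv ℝ φ x) (C := K * ‖y - x‖) (x := x) (y := y)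
    (fun z hz => ((hball (hsub hz)).2 : DifferentiableAt ℝ φ z).hasFDerivAt.hasFDerivWithinAt)
    (fun z hz => by
      have h2 := hK.dist_le_mul z (hball (hsub hz)).1 x (hball (hsub hx0)).1
      rw [dist_eq_norm] at h2
      refine h2.trans ?_
      gcongr
      exact hz)
    hx0 (by simp [dist_eq_norm])
  rw [Real.norm_eq_abs] at this
  rwa [sq, ← mul_assoc]

/-! ### The estimator as a sample mean of smoothed indicators -/

section law

variable {d : ℕ} {m : Fin d → ℕ} {x : Fin d → ℝ}

theorem abs_indicator_Iic_le (y z : Fin d → ℝ) :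
    |(Set.Iic y).indicator (fun _ => (1 : ℝ)) z| ≤ 1 := by
  by_cases h : z ∈ Set.Iic y <;> simp [h]

/-- The contribution `∑ₖ 1{y ≤ k/m} P_{k,m}(x)` of a sample point `y` to the estimator. -/
noncomputable def smoothedIndicator {d : ℕ} (m : Fin d → ℕ) (x y : Fin d → ℝ) : ℝ :=
  szaszOperator m x fun z => (Set.Iic z).indicator (fun _ => (1 : ℝ)) y

theorem abs_smoothedIndicator_le (y : Fin d → ℝ) : |smoothedIndicator m x y| ≤ 1 :=
  abs_szaszOperator_le fun z => abs_indicator_Iic_le z y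

/-- The second variable is countable, so measurability in `y` for each fixed `k` is enough. -/
theorem measurable_indicator_Iic_uncurry :
    Measurable (Function.uncurry fun (y : Fin d → ℝ) (k : Fin d → ℕ) =>
      (Set.Iic fun j => (k j : ℝ) / (m j : ℝ)).indicator (fun _ => (1 : ℝ)) y) :=
  measurable_from_prod_countable_left fun k =>
    (measurable_const.indicator (measurableSet_Iic (a := fun j => (k j : ℝ) / (m j : ℝ))) :
      Measurable ((Set.Iic fun j => (k j : ℝ) / (m j : ℝ)).indicator fun _ => (1 : ℝ)))

theorem measurable_smoothedIndicator : Measurable (smoothedIndicator m x) :=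
  (measurable_indicator_Iic_uncurry.stronglyMeasurable.integral_prod_right
    (ν := poissonPi m x)).measurable

theorem estimator_eq_sum (hx : ∀ j, 0 ≤ x j) (n : ℕ) (X : ℕ → Fin d → ℝ) :
    estimator m n X x = (1 / (n : ℝ)) * ∑ i ∈ Finset.range n, smoothedIndicator m x (X i) := by
  have hs : ∀ i, Summable fun k : Fin d → ℕ =>
      (Set.Iic fun j => (k j : ℝ) / (m j : ℝ)).indicator (fun _ => (1 : ℝ)) (X i) *
        poissonWeight k m x := fun i =>
    Summable.of_norm_bounded (summable_poissonWeight m x hx) fun k => by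
      have hw : 0 ≤ poissonWeight k m x := Finset.prod_nonneg fun j _ => by
        have := hx j
        positivity
      rw [norm_mul, Real.norm_of_nonneg hw, Real.norm_eq_abs]
      exact mul_le_of_le_one_left hw (abs_indicator_Iic_le _ _)
  have h : ∀ i, smoothedIndicator m x (X i) = ∑' k : Fin d → ℕ,
      (Set.Iic fun j => (k j : ℝ) / (m j : ℝ)).indicator (fun _ => (1 : ℝ)) (X i) *
        poissonWeight k m x := fun i =>
    szaszOperator_eq_tsum hx fun z => abs_indicator_Iic_le z _
  simp_rw [h]
  rw [← Summable.tsum_finsetSum fun i _ => hs i, ← tsum_mul_left, estimator]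
  simp_rw [empiricalCDF, mul_assoc, Finset.sum_mul]

variable (μ : Measure (Fin d → ℝ))

theorem integral_indicator_Iic (z : Fin d → ℝ) :
    ∫ y, (Set.Iic z).indicator (fun _ => (1 : ℝ)) y ∂μ = distFun μ z := by
  rw [integral_indicator_const _ measurableSet_Iic]
  simp [distFun]

variable [IsProbabilityMeasure μ]

theorem abs_distFun_le (z : Fin d → ℝ) : |distFun μ z| ≤ 1 := by
  rw [distFun, abs_of_nonneg measureReal_nonneg]
  exact measureReal_le_one

theorem integral_smoothedIndicator :
    ∫ y, smoothedIndicator m x y ∂μ = szaszOperator m x (distFun μ) := by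
  simp only [smoothedIndicator, szaszOperator]
  rw [integral_integral_swap]
  · simp_rw [integral_indicator_Iic]
  · exact Integrable.of_bound measurable_indicator_Iic_uncurry.aestronglyMeasurable 1
      (ae_of_all _ fun p => abs_indicator_Iic_le _ _)

variable {μ}

/-- At a continuity point of the distribution function, the boundary of the lower orthant is
null. -/
theorem ae_le_imp_lt (hc : ContinuousAt (distFun μ) x) : ∀ᵐ y ∂μ, y ≤ x → ∀ j, y j < x j := by
  set s : Set (Fin d → ℝ) := {y | ¬(y ≤ x → ∀ j, y j < x j)}
  change μ s = 0
  rw [← measureReal_eq_zero_iff]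
  refine le_antisymm ?_ measureReal_nonneg
  -- For every `ε > 0` the exceptional set lies in the orthant below `x` minus the one below `x -
  -- ε`, whose mass tends to zero by continuity.
  have ht : Tendsto (fun ε : ℝ => distFun μ x - distFun μ (fun j => x j - ε)) (𝓝[>] 0) (𝓝 0) := by
    have h1 : Tendsto (fun ε : ℝ => fun j => x j - ε) (𝓝[>] 0) (𝓝 x) := by
      have : Continuous (fun ε : ℝ => fun j => x j - ε) := by fun_prop
      simpa using (this.tendsto 0).mono_left nhdsWithin_le_nhds
    have h2 := (tendsto_const_nhds (x := distFun μ x)).sub (hc.tendsto.comp h1)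
    rwa [sub_self] at h2
  refine ge_of_tendsto ht (eventually_nhdsWithin_of_forall fun ε (hε : 0 < ε) => ?_)
  rw [distFun, distFun, ← measureReal_sdiff (fun y hy j => (hy j).trans (by simp [hε.le]))
    measurableSet_Iic]
  refine measureReal_mono fun y hy => ?_
  simp only [s, Set.mem_ofPred_eq, not_forall, not_lt] at hy
  obtain ⟨h1, j, h2⟩ := hy
  refine ⟨h1, fun h3 => ?_⟩
  have := h3 j
  simp only at this
  linarith

/-- For such `y`, the map `z ↦ 1{y ≤ z}` is constant near `x`, so its Taylor remainder with `L = 0`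
vanishes locally and the operator error bound applies. -/
theorem tendsto_smoothedIndicator (hx : ∀ j, 0 ≤ x j) {m : ℕ → Fin d → ℕ} (hm : ∀ n j, 1 ≤ m n j)
    (hmin : Tendsto (fun n => mMin (m n)) atTop atTop) {y : Fin d → ℝ}
    (hy : y ≤ x → ∀ j, y j < x j) :
    Tendsto (fun n => smoothedIndicator (m n) x y) atTop
      (𝓝 ((Set.Iic x).indicator (fun _ => (1 : ℝ)) y)) := by
  have hloc : ∀ᶠ z in 𝓝 x, (Set.Iic z).indicator (fun _ => (1 : ℝ)) y =
      (Set.Iic x).indicator (fun _ => (1 : ℝ)) y := by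
    by_cases h : y ≤ x
    · have : ∀ᶠ z in 𝓝 x, ∀ j, y j < z j :=
        eventually_all.2 fun j => (continuous_apply j).continuousAt.eventually_const_lt (hy h j)
      filter_upwards [this] with z hz
      have : y ≤ z := fun j => (hz j).le
      simp [h, this]
    · obtain ⟨j, hj⟩ := not_forall.1 (fun h' => h h' : ¬∀ j, y j ≤ x j)
      filter_upwards [(continuous_apply j).continuousAt.eventually_lt_const (not_le.1 hj)] with z hz
      have : ¬y ≤ z := fun h' => (h' j).not_gt hz
      simp [h, this]
  obtain ⟨C, hC0, hC⟩ := exists_taylor_bound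
    (φ := fun z => (Set.Iic z).indicator (fun _ => (1 : ℝ)) y)
    (fun z => abs_indicator_Iic_le z y) (x := x) 0 (K := 0)
    (hloc.mono fun z hz => by simp [hz])
  have hlim : Tendsto (fun n => C * (∑ j, x j) / (mMin (m n) : ℝ)) atTop (𝓝 0) :=
    tendsto_const_nhds.div_atTop (tendsto_natCast_atTop_atTop.comp hmin)
  rw [tendsto_iff_norm_sub_tendsto_zero]
  exact squeeze_zero (fun _ => norm_nonneg _) (fun n => abs_szaszOperator_sub_le (hm n) hx
    (fun z => abs_indicator_Iic_le z y) 0 hC0 hC) hlim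

end law

/-! ### Negligibility of normalised sums -/

section asymptotics

variable {Ω E : Type*} [MeasurableSpace Ω] [MeasurableSpace E] {P : Measure Ω}
  {μ : Measure E} {X : ℕ → Ω → E}

theorem integral_comp_hasLaw (hlaw : ∀ i, HasLaw (X i) μ P) {f : E → ℝ} (hf : Measurable f)
    (i : ℕ) : ∫ ω, f (X i ω) ∂P = ∫ y, f y ∂μ :=
  (hlaw i).integral_comp hf.aestronglyMeasurable

theorem identDistrib_comp (hlaw : ∀ i, HasLaw (X i) μ P) {f : E → ℝ} (hf : Measurable f)
    (i : ℕ) : IdentDistrib (fun ω => f (X i ω)) f P μ :=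
  ((hlaw i).identDistrib HasLaw.id).comp hf

theorem tendstoInMeasure_of_tendsto_const {b : ℕ → ℝ} (hb : Tendsto b atTop (𝓝 0)) :
    TendstoInMeasure P (fun n (_ : Ω) => b n) atTop 0 := by
  rw [tendstoInMeasure_iff_norm]
  intro ε hε
  refine tendsto_const_nhds.congr' ?_
  filter_upwards [hb.norm.eventually_lt_const (by simpa using hε)] with n hn
  have : {ω : Ω | ε ≤ ‖b n - (0 : Ω → ℝ) ω‖} = ∅ :=
    Set.eq_empty_of_forall_notMem fun ω hω => hn.not_ge (by simpa using hω)
  rw [this, measure_empty]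

variable [IsProbabilityMeasure P]

theorem memLp_two_comp (hlaw : ∀ i, HasLaw (X i) μ P) {f : E → ℝ} (hf : Measurable f) {c : ℝ}
    (hc : ∀ y, |f y| ≤ c) (i : ℕ) : MemLp (fun ω => f (X i ω)) 2 P :=
  MemLp.of_bound (hf.comp_aemeasurable (hlaw i).aemeasurable).aestronglyMeasurable c
    (ae_of_all _ fun _ => hc _)

theorem variance_sum_comp (hlaw : ∀ i, HasLaw (X i) μ P) (hindep : iIndepFun X P) {f : E → ℝ}
    (hf : Measurable f) {c : ℝ} (hc : ∀ y, |f y| ≤ c) (n : ℕ) :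
    Var[∑ i ∈ Finset.range n, fun ω => f (X i ω); P] = n * Var[f; μ] := by
  rw [IndepFun.variance_sum (fun i _ => memLp_two_comp hlaw hf hc i)
    (fun i _ j _ hij => (hindep.indepFun hij).comp hf hf)]
  simp [fun i => (identDistrib_comp hlaw hf i).variance_eq]

variable [IsProbabilityMeasure μ]

/-- Normalised centred sums of bounded functions of an i.i.d. sample are negligible in probability
as soon as the functions tend to zero in `L²`. -/
theorem tendstoInMeasure_normalized_sum (hlaw : ∀ i, HasLaw (X i) μ P) (hindep : iIndepFun X P)
    {D : ℕ → E → ℝ} (hD : ∀ n, Measurable (D n)) {c : ℝ} (hc : ∀ n y, |D n y| ≤ c)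
    (hlim : Tendsto (fun n => ∫ y, D n y ^ 2 ∂μ) atTop (𝓝 0)) :
    TendstoInMeasure P (fun (n : ℕ) ω =>
      (√(n : ℝ))⁻¹ * (∑ i ∈ Finset.range n, D n (X i ω) - n * ∫ y, D n y ∂μ)) atTop 0 := by
  rw [tendstoInMeasure_iff_norm]
  intro ε hε
  have hlim' : Tendsto (fun n => ENNReal.ofReal ((∫ y, D n y ^ 2 ∂μ) / ε ^ 2)) atTop (𝓝 0) := by
    simpa using (ENNReal.tendsto_ofReal (hlim.div_const (ε ^ 2)))
  refine tendsto_of_tendsto_of_tendsto_of_le_of_le' tendsto_const_nhds hlim'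
    (Eventually.of_forall fun _ => zero_le) ?_
  filter_upwards [eventually_ge_atTop 1] with n hn
  have hn0 : (0 : ℝ) < n := by exact_mod_cast hn
  have hs : (0 : ℝ) < √(n : ℝ) := Real.sqrt_pos.2 hn0
  set S : Ω → ℝ := ∑ i ∈ Finset.range n, fun ω => D n (X i ω) with hS
  have hSm : MemLp S 2 P :=
    memLp_finsetSum' _ fun i _ => memLp_two_comp hlaw (hD n) (hc n) i
  have hSE : P[S] = n * ∫ y, D n y ∂μ := by
    simp only [hS, Finset.sum_apply]
    rw [integral_finsetSum _ fun i _ =>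
      (memLp_two_comp hlaw (hD n) (hc n) i).integrable (by norm_num)]
    simp [fun i => integral_comp_hasLaw hlaw (hD n) i]
  -- Chebyshev at level `√n * ε`: the factor `n` in the variance of the sum cancels.
  have hcheb := meas_ge_le_variance_div_sq hSm (c := √(n : ℝ) * ε) (by positivity)
  rw [variance_sum_comp hlaw hindep (hD n) (hc n), hSE] at hcheb
  refine (measure_mono fun ω hω => ?_).trans (hcheb.trans (ENNReal.ofReal_le_ofReal ?_))
  · simp only [Set.mem_ofPred_eq, Pi.zero_apply, sub_zero, norm_mul, norm_inv, Real.norm_eq_abs,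
      abs_of_pos hs] at hω ⊢
    rw [inv_mul_eq_div, le_div_iff₀ hs] at hω
    simpa [hS, mul_comm] using hω
  · rw [mul_pow, Real.sq_sqrt hn0.le, mul_div_mul_left _ _ hn0.ne']
    gcongr
    exact variance_le_expectation_sq (hD n).aestronglyMeasurable

end asymptotics

end SzaszMirakyan

/-! ### Asymptotic normality -/

open SzaszMirakyan in
theorem mainTheorem6 {d : ℕ} {Ω : Type*} [MeasurableSpace Ω]
    (P : Measure Ω) [IsProbabilityMeasure P]
    -- the common law, supported on the nonnegative orthant
    (μ : Measure (Fin d → ℝ)) [IsProbabilityMeasure μ]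
    (hsupp : ∀ᵐ y ∂μ, ∀ j, 0 ≤ y j)
    -- the i.i.d. sample
    (X : ℕ → Ω → Fin d → ℝ)
    (hlaw : ∀ i, HasLaw (X i) μ P)
    (hindep : iIndepFun X P)
    -- regularity of the distribution function
    (hF : SzaszMirakyan.InteriorC2 (SzaszMirakyan.distFun μ))
    -- the evaluation point
    (x : Fin d → ℝ) (hx : x ∈ SzaszMirakyan.openOrthant d)
    (hFx : SzaszMirakyan.distFun μ x ∈ Set.Ioo (0 : ℝ) 1)
    -- the smoothing parameters `m = m(n)`
    (m : ℕ → Fin d → ℕ) (hm : ∀ n j, 1 ≤ m n j)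
    (hmin : Tendsto (fun n => SzaszMirakyan.mMin (m n)) atTop atTop) :
    (∀ n, Integrable (fun ω => SzaszMirakyan.estimator (m n) n (fun i => X i ω) x) P) ∧
    TendstoInDistribution
      (fun (n : ℕ) ω => √(n : ℝ) *
        (SzaszMirakyan.estimator (m n) n (fun i => X i ω) x
          - ∫ ω', SzaszMirakyan.estimator (m n) n (fun i => X i ω') x ∂P))
      atTop (id : ℝ → ℝ) (fun _ => P)
      (gaussianReal 0
        (SzaszMirakyan.distFun μ x * (1 - SzaszMirakyan.distFun μ x)).toNNReal) ∧
    (Tendsto (fun n : ℕ => √(n : ℝ) * ((SzaszMirakyan.mMin (m n) : ℝ))⁻¹) atTop (𝓝 0) →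
      TendstoInDistribution
        (fun (n : ℕ) ω => √(n : ℝ) *
          (SzaszMirakyan.estimator (m n) n (fun i => X i ω) x - SzaszMirakyan.distFun μ x))
        atTop (id : ℝ → ℝ) (fun _ => P)
        (gaussianReal 0
          (SzaszMirakyan.distFun μ x * (1 - SzaszMirakyan.distFun μ x)).toNNReal)) := by
  have hx0 : ∀ j, 0 ≤ x j := fun j => (hx j).le
  have hopen : IsOpen (openOrthant d) := by
    simp only [openOrthant, Set.ofPred_forall]
    exact isOpen_iInter_of_finite fun j => isOpen_lt continuous_const (continuous_apply j)
  have hC2 : ContDiffAt ℝ 2 (distFun μ) x := hF.contDiffOn.contDiffAt (hopen.mem_nhds hx)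
  set h : (Fin d → ℝ) → ℝ := (Set.Iic x).indicator fun _ => (1 : ℝ) with hh
  have hhm : Measurable h := measurable_const.indicator measurableSet_Iic
  have hgm : ∀ n, Measurable (smoothedIndicator (m n) x) := fun n => measurable_smoothedIndicator
  have hgi : ∀ n i, Integrable (fun ω => smoothedIndicator (m n) x (X i ω)) P := fun n i =>
    (memLp_two_comp hlaw (hgm n) abs_smoothedIndicator_le i).integrable (by norm_num)
  have hint : ∀ n, Integrable (fun ω => estimator (m n) n (fun i => X i ω) x) P := fun n => by
    simp_rw [estimator_eq_sum hx0]
    exact (integrable_finsetSum _ fun i _ => hgi n i).const_mul _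
  -- At `n = 0` the estimator is `0`, since `1 / 0 = 0`, so that case is excluded; the factor `√n`
  -- makes it harmless later.
  have hE : ∀ n : ℕ, n ≠ 0 → ∫ ω, estimator (m n) n (fun i => X i ω) x ∂P =
      szaszOperator (m n) x (distFun μ) := fun n hn => by
    have : (n : ℝ) ≠ 0 := Nat.cast_ne_zero.2 hn
    simp_rw [estimator_eq_sum hx0]
    rw [integral_const_mul, integral_finsetSum _ fun i _ => hgi n i]
    simp only [fun i => integral_comp_hasLaw hlaw (hgm n) i, integral_smoothedIndicator]
    simp [this]
  have hvar : Var[fun ω => h (X 0 ω); P] = distFun μ x * (1 - distFun μ x) := by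
    rw [(identDistrib_comp hlaw hhm 0).variance_eq, variance_eq_sub
      (MemLp.of_bound hhm.aestronglyMeasurable 1 (ae_of_all _ fun y => abs_indicator_Iic_le x y))]
    have hsq : h ^ 2 = h := by
      ext y
      by_cases hy : y ∈ Set.Iic x <;> simp [hh, hy]
    rw [hsq, integral_indicator_Iic]
    ring
  have hclt : TendstoInDistribution (fun (n : ℕ) ω =>
      (√(n : ℝ))⁻¹ * (∑ i ∈ Finset.range n, h (X i ω) - n * distFun μ x)) atTop (id : ℝ → ℝ)
      (fun _ => P) (gaussianReal 0 (distFun μ x * (1 - distFun μ x)).toNNReal) := by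
    have := tendstoInDistribution_inv_sqrt_mul_sum_sub (P := P) (X := fun i ω => h (X i ω))
      (Y := id) (P' := gaussianReal 0 (distFun μ x * (1 - distFun μ x)).toNNReal)
      (by rw [hvar]; exact HasLaw.id)
      (memLp_two_comp hlaw hhm (abs_indicator_Iic_le x) 0)
      (hindep.comp (fun _ => h) fun _ => hhm)
      (fun i => (identDistrib_comp hlaw hhm i).trans (identDistrib_comp hlaw hhm 0).symm)
    rwa [integral_comp_hasLaw hlaw hhm, integral_indicator_Iic] at this
  have hDlim : Tendsto (fun n => ∫ y, (smoothedIndicator (m n) x y - h y) ^ 2 ∂μ) atTop (𝓝 0) := by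
    have := tendsto_integral_of_dominated_convergence (μ := μ)
      (F := fun n y => (smoothedIndicator (m n) x y - h y) ^ 2) (f := fun _ => (0 : ℝ))
      (fun _ => (2 : ℝ) ^ 2)
      (fun n => (((hgm n).sub hhm).pow_const 2).aestronglyMeasurable) (integrable_const _)
      (fun n => ae_of_all _ fun y => ?_) ?_
    · simpa using this
    · rw [norm_pow, Real.norm_eq_abs]
      have h1 := abs_smoothedIndicator_le (m := m n) (x := x) y
      have h2 := abs_indicator_Iic_le x y
      have h3 := abs_sub (smoothedIndicator (m n) x y) (h y)
      gcongr
      linarith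
    · filter_upwards [ae_le_imp_lt hC2.continuousAt] with y hy
      have := ((tendsto_smoothedIndicator hx0 hm hmin hy).sub_const (h y)).pow 2
      rwa [sub_self, zero_pow two_ne_zero] at this
  have hmeas := tendstoInMeasure_normalized_sum hlaw hindep
    (D := fun n y => smoothedIndicator (m n) x y - h y) (fun n => (hgm n).sub hhm) (c := 2)
    (fun n y => by
      have h1 := abs_smoothedIndicator_le (m := m n) (x := x) y
      have h2 := abs_indicator_Iic_le x y
      have h3 := abs_sub (smoothedIndicator (m n) x y) (h y)
      linarith) hDlim
  have ha : TendstoInDistribution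
      (fun (n : ℕ) ω => √(n : ℝ) * (estimator (m n) n (fun i => X i ω) x
          - ∫ ω', estimator (m n) n (fun i => X i ω') x ∂P))
      atTop (id : ℝ → ℝ) (fun _ => P)
      (gaussianReal 0 (distFun μ x * (1 - distFun μ x)).toNNReal) := by
    refine tendstoInDistribution_of_tendstoInMeasure_sub _ _ hclt ?_ fun n =>
      ((hint n).aemeasurable.sub_const _).const_mul _
    -- The statistic minus the normalised sum of `1{X i ≤ x}` is exactly the normalised centred sum
    -- of `D n`.
    convert hmeas using 1
    ext n ω
    rcases eq_or_ne n 0 with rfl | hn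
    · simp
    have hn0 : (0 : ℝ) < n := by positivity
    have hs : √(n : ℝ) ≠ 0 := (Real.sqrt_pos.2 hn0).ne'
    have hs2 : √(n : ℝ) * √(n : ℝ) = n := Real.mul_self_sqrt hn0.le
    have hgμ : Integrable (smoothedIndicator (m n) x) μ :=
      Integrable.of_bound (hgm n).aestronglyMeasurable 1
        (ae_of_all _ fun y => abs_smoothedIndicator_le y)
    have hhμ : Integrable h μ :=
      Integrable.of_bound hhm.aestronglyMeasurable 1 (ae_of_all _ fun y => abs_indicator_Iic_le x y)
    rw [integral_sub hgμ hhμ, integral_smoothedIndicator, integral_indicator_Iic,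
      Finset.sum_sub_distrib]
    simp only [Pi.sub_apply]
    have k1 : √(n : ℝ) * (1 / n) = (√(n : ℝ))⁻¹ := by
      rw [mul_one_div, eq_comm, inv_eq_one_div, div_eq_div_iff hs hn0.ne', hs2, one_mul]
    have k2 : (√(n : ℝ))⁻¹ * n = √(n : ℝ) := by
      rw [inv_mul_eq_div, div_eq_iff hs, hs2]
    rw [hE n hn, estimator_eq_sum hx0]
    linear_combination (∑ i ∈ Finset.range n, smoothedIndicator (m n) x (X i ω)) * k1 +
      szaszOperator (m n) x (distFun μ) * k2
  refine ⟨hint, ha, fun hrate => ?_⟩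
  -- Slutsky again: the statistics of (a) and (b) differ by the deterministic quantity `√n` times
  -- the bias.
  refine tendstoInDistribution_of_tendstoInMeasure_sub _ _ ha ?_ fun n =>
    ((hint n).aemeasurable.sub_const _).const_mul _
  obtain ⟨K, hK⟩ := eventually_taylor_bound hC2
  obtain ⟨C, hC0, hC⟩ := exists_taylor_bound (abs_distFun_le μ) _ hK
  have hb : Tendsto (fun n : ℕ => √(n : ℝ) *
      ((∫ ω, estimator (m n) n (fun i => X i ω) x ∂P) - distFun μ x)) atTop (𝓝 0) := by
    have hlim := hrate.const_mul (C * ∑ j, x j)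
    rw [mul_zero] at hlim
    refine squeeze_zero_norm (fun n => ?_) hlim
    rcases eq_or_ne n 0 with rfl | hn
    · simp
    rw [hE n hn, norm_mul, Real.norm_of_nonneg (Real.sqrt_nonneg _), Real.norm_eq_abs,
      mul_left_comm, ← div_eq_mul_inv]
    exact mul_le_mul_of_nonneg_left (abs_szaszOperator_sub_le (hm n) hx0 (abs_distFun_le μ) _
      hC0 hC) (Real.sqrt_nonneg _)
  convert tendstoInMeasure_of_tendsto_const (P := P) hb using 1
  ext n ω
  simp only [Pi.sub_apply]
  ring
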